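/- Let $m,k,n\ge 0$ be integers with $k<\min\{m,n\}$, and let $\mathcal M(W_1,W_2)=W_1W_2$ for $W_1\in\mathbb R^{m\times k}$, $W_2\in\mathbb R^{k\times n}$. The range of $\mathcal M$ is $\mathcal R=\{Z\in\mathbb R^{m\times n}:\operatorname{rank} Z\le k\}$. Let $\|\cdot\|$ be the Frobenius norm. For $\varepsilon,\delta>0$ say that $\delta$ is admissible for $\varepsilon$ at $(W_1,W_2)$ if every $Z\in\mathcal R$ with $\|Z-W_1W_2\|<\delta$ can be written as $Z=W_1'W_2'$ with $\|W_1'-W_1\|<\varepsilon$ and $\|W_2'-W_2\|<\varepsilon$. The mapping $\mathcal M$ is locally open at $(W_1,W_2)$ in its range if every $\varepsilon>0$ has an admissible $\delta>0$. Let $\mathcal N(\cdot)$ and $\mathcal C(\cdot)$ denote the null space and the column space. (a) If $\operatorname{rank} W_1\neq\operatorname{rank} W_2$, then $\mathcal M$ is not locally open at $(W_1,W_2)$ in its range. (b) If $\operatorname{rank} W_1=\operatorname{rank} W_2$, then the following statements are equivalent: (i) there is $\widetilde W_1\in\mathbb R^{m\times k}$ with $\widetilde W_1W_2=0$ and $W_1+\widetilde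 W_1$ of full column rank $k$; (ii) there is $\widetilde W_2\in\mathbb R^{k\times n}$ with $W_1\widetilde W_2=0$ and $W_2+\widetilde W_2$ of full row rank $k$; (iii) $\dim(\mathcal N(W_1)\cap\mathcal C(W_2))=0$; (iv) $\dim(\mathcal N(W_2^T)\cap\mathcal C(W_1^T))=0$; (v) $\mathcal M$ is locally open at $(W_1,W_2)$ in its range. (c) If $\mathcal M$ is locally open at $(W_1,W_2)$ in its range, then one can choose for every $\varepsilon>0$ an admissible $\delta(\varepsilon)>0$ such that, as $\varepsilon\to0^+$, $\delta(\varepsilon)=O(\varepsilon)$ and $\varepsilon^2=O(\delta(\varepsilon))$; if moreover $\operatorname{rank} W_1=k$, then also $\varepsilon=O(\delta(\varepsilon))$, so that $\delta$ is exactly of order $\varepsilon$. -/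

import Mathlib

open Filter Topology Asymptotics

attribute [local instance] Matrix.frobeniusNormedAddCommGroup

/-- The inclusion `B_δ(F w) ∩ R ⊆ F (B_ε(w))`: every point of `R` at distance less than `δ`
from `F w` is attained by `F` at some point at distance less than `ε` from `w`. -/
def CoversBall {X Y : Type*} [PseudoMetricSpace X] [PseudoMetricSpace Y]
    (F : X → Y) (R : Set Y) (w : X) (ε δ : ℝ) : Prop :=
  Metric.ball (F w) δ ∩ R ⊆ F '' Metric.ball w ε

/-- `F` is locally open at `w` relative to the set `R` (typically its range). -/
def LocallyOpenAtIn {X Y : Type*} [PseudoMetricSpace X] [PseudoMetricSpace Y]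
    (F : X → Y) (R : Set Y) (w : X) : Prop :=
  ∀ ε : ℝ, 0 < ε → ∃ δ : ℝ, 0 < δ ∧ CoversBall F R w ε δ

/-- The matrix multiplication mapping `(W₁, W₂) ↦ W₁ W₂`. The metric on pairs is the maximum of
the two Frobenius distances, so that a ball around a pair is a product of two balls. -/
def matMul (m k n : ℕ) :
    Matrix (Fin m) (Fin k) ℝ × Matrix (Fin k) (Fin n) ℝ → Matrix (Fin m) (Fin n) ℝ :=
  fun W => W.1 * W.2

/-- The `m × n` real matrices of rank at most `min (m, n, k)`: the range of `matMul m k n`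
(see `range_matMul`). -/
def lowRank (m k n : ℕ) : Set (Matrix (Fin m) (Fin n) ℝ) :=
  {Z | Z.rank ≤ min (min m n) k}

/-- The null space of a matrix. -/
def nullSp {m n : ℕ} (A : Matrix (Fin m) (Fin n) ℝ) : Submodule ℝ (Fin n → ℝ) :=
  LinearMap.ker A.mulVecLin

/-- The column space of a matrix. -/
def colSp {m n : ℕ} (A : Matrix (Fin m) (Fin n) ℝ) : Submodule ℝ (Fin m → ℝ) :=
  LinearMap.range A.mulVecLin

/-- The set `lowRank m k n` is the range of the multiplication mapping. -/
theorem range_matMul (m k n : ℕ) : Set.range (matMul m k n) = lowRank m k n := by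
  ext Z
  constructor
  · rintro ⟨⟨A, B⟩, rfl⟩
    change (A * B).rank ≤ min (min m n) k
    refine le_min (le_min ?_ ?_) ?_
    · simpa [matMul] using (A * B).rank_le_card_height
    · simpa [matMul] using (A * B).rank_le_card_width
    · refine (Matrix.rank_mul_le_left A B).trans ?_
      simpa using A.rank_le_card_width
  · intro hZ
    have hk : Module.finrank ℝ (LinearMap.range Z.mulVecLin) ≤ Module.finrank ℝ (Fin k → ℝ) := by
      have : Z.rank ≤ k := le_trans hZ (min_le_right _ _)
      simpa [Matrix.rank] using this
    obtain ⟨f, hf⟩ := finrank_le_iff_exists_linearMap.1 hk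
    obtain ⟨g, hg⟩ := LinearMap.exists_leftInverse_of_injective f (LinearMap.ker_eq_bot.2 hf)
    refine ⟨(LinearMap.toMatrix' ((LinearMap.range Z.mulVecLin).subtype ∘ₗ g),
      LinearMap.toMatrix' (f ∘ₗ Z.mulVecLin.rangeRestrict)), ?_⟩
    simp only [matMul]
    rw [← LinearMap.toMatrix'_comp]
    have h : ((LinearMap.range Z.mulVecLin).subtype ∘ₗ g) ∘ₗ (f ∘ₗ Z.mulVecLin.rangeRestrict)
        = Matrix.toLin' Z := by
      ext x : 1
      ext i
      have := LinearMap.congr_fun hg (Z.mulVecLin.rangeRestrict (Pi.single x 1))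
      simp only [LinearMap.comp_apply, LinearMap.id_apply] at this
      simp [this]
    rw [h, LinearMap.toMatrix'_toLin']

/-!
Openness at `(X, Y)` holds exactly when `rank (X Y) = rank X = rank Y`.

If `X Y v = 0` with `v ≠ 0`, then `X Y` is a limit of products `Z` of rank `k` with `Z v = 0`. Every
factorization `Z = X' Y'` has `X'` injective, so `Y' v = 0`. By openness the pairs `(X', Y')` can be
taken to converge to `(X, Y)`, whence `Y v = 0` and `rank (X Y) = rank Y`; transposition gives
`rank (X Y) = rank X`.

If the three ranks agree, then `X = P R` and `Y = L Q` with `R L = 1` and `X Y = P Q` a full-rank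
factorization. Any `Z` near `P Q` is `P' Q' + S` with `P' - P`, `Q' - Q`, `S` of order `‖Z - P Q‖`
and `rank S ≤ rank Z - rank (X Y)`. So `S` factors through the complement of `R` and `L` in `𝕜ᵏ`,
with both factors of order `√‖S‖`: this gives `δ ~ ε²`. When `rank X = k` there is no room for
`S`, and `δ ~ ε`.
-/

section RankFactorization

variable {K : Type*} [Field K] {m n k q r : Type*} [Fintype n] [Fintype k]

theorem exists_rank_factorization [Fintype m] {M : Matrix m n K} {r : ℕ} (hr : M.rank = r) :
    ∃ (P : Matrix m (Fin r) K) (Q : Matrix (Fin r) n K)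
      (A : Matrix (Fin r) m K) (B : Matrix n (Fin r) K),
      P * Q = M ∧ A * P = 1 ∧ Q * B = 1 := by
  classical
  let e := (Module.finBasisOfFinrankEq K (LinearMap.range M.mulVecLin) hr).equivFun
  let ι := (LinearMap.range M.mulVecLin).subtype ∘ₗ e.symm.toLinearMap
  let π := e.toLinearMap ∘ₗ M.mulVecLin.rangeRestrict
  have hι : LinearMap.ker ι = ⊥ :=
    LinearMap.ker_eq_bot.2 (Subtype.val_injective.comp e.symm.injective)
  have hπ : LinearMap.range π = ⊤ :=
    LinearMap.range_eq_top.2 (e.surjective.comp M.mulVecLin.surjective_rangeRestrict)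
  obtain ⟨α, hα⟩ := ι.exists_leftInverse_of_injective hι
  obtain ⟨β, hβ⟩ := π.exists_rightInverse_of_surjective hπ
  refine ⟨LinearMap.toMatrix' ι, LinearMap.toMatrix' π, LinearMap.toMatrix' α,
    LinearMap.toMatrix' β, ?_, ?_, ?_⟩
  · have hιπ : ι ∘ₗ π = Matrix.toLin' M := LinearMap.ext fun x => by simp [ι, π]
    rw [← LinearMap.toMatrix'_comp, hιπ, LinearMap.toMatrix'_toLin']
  · rw [← LinearMap.toMatrix'_comp, hα, LinearMap.toMatrix'_id]
  · rw [← LinearMap.toMatrix'_comp, hβ, LinearMap.toMatrix'_id]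

theorem exists_complementary_inverses [Fintype m] [Fintype r] [Fintype q]
    [DecidableEq r] [DecidableEq q] {A : Matrix r m K} {P : Matrix m r K} (hAP : A * P = 1)
    (hq : Fintype.card r + Fintype.card q ≤ Fintype.card m) :
    ∃ (T : Matrix m q K) (S : Matrix q m K), S * T = 1 ∧ A * T = 0 ∧ S * P = 0 := by
  classical
  obtain ⟨s, hs⟩ : ∃ s, (1 - P * A).rank = s := ⟨_, rfl⟩
  obtain ⟨T, S, T', S', hTS, hT, hS⟩ := exists_rank_factorization hs
  have hAT : A * T = 0 := calc
    A * T = A * (T * S) * S' := by rw [← Matrix.mul_assoc, Matrix.mul_assoc, hS, Matrix.mul_one]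
    _ = 0 := by simp [hTS, Matrix.mul_sub, ← Matrix.mul_assoc, hAP]
  have hSP : S * P = 0 := calc
    S * P = T' * (T * S) * P := by rw [← Matrix.mul_assoc T', hT, Matrix.one_mul]
    _ = 0 := by simp [hTS, Matrix.mul_assoc, Matrix.sub_mul, hAP]
  have hST : S * T = 1 := calc
    S * T = T' * (T * S) * T := by rw [← Matrix.mul_assoc T', hT, Matrix.one_mul]
    _ = 1 := by simp [hTS, Matrix.mul_assoc, Matrix.sub_mul, hAT, hT]
  have hcard : Fintype.card q ≤ Fintype.card (Fin s) := by
    have hsum : Matrix.fromCols P T * Matrix.fromRows A S = 1 := by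
      rw [Matrix.fromCols_mul_fromRows, hTS, add_sub_cancel]
    have hm := (Matrix.rank_mul_le_left (Matrix.fromCols P T) (Matrix.fromRows A S)).trans
      (Matrix.rank_le_card_width _)
    rw [hsum, Matrix.rank_one, Fintype.card_sum] at hm
    omega
  obtain ⟨e⟩ := Function.Embedding.nonempty_of_card_le hcard
  refine ⟨T.submatrix id e, S.submatrix e id, ?_, ?_, ?_⟩
  · rw [← Matrix.submatrix_mul _ _ _ _ _ Function.bijective_id, hST,
      Matrix.submatrix_one_embedding]
  · exact congrArg (Matrix.submatrix · id e) hAT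
  · exact congrArg (Matrix.submatrix · e id) hSP

theorem add_mul_add_of_complementary {l : Type*} [Fintype q] [Fintype r]
    [DecidableEq q] [DecidableEq r] {R : Matrix r k K} {L : Matrix k r K} {N : Matrix q k K}
    {J : Matrix k q K}
    (hRL : R * L = 1) (hNJ : N * J = 1) (hRJ : R * J = 0) (hNL : N * L = 0)
    (P : Matrix m r K) (T : Matrix m q K) (Q : Matrix r l K) (V : Matrix q l K) :
    (P * R + T * N) * (L * Q + J * V) = P * Q + T * V := calc
  (P * R + T * N) * (L * Q + J * V)
      = P * (R * L) * Q + P * (R * J) * V + (T * (N * L) * Q + T * (N * J) * V) := by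
    simp only [Matrix.add_mul, Matrix.mul_add, Matrix.mul_assoc]
    abel
  _ = P * Q + T * V := by simp [hRL, hNJ, hRJ, hNL]

theorem rank_mul_add_finrank_ker_inf_range (X : Matrix m k K) (Y : Matrix k n K) :
    (X * Y).rank + Module.finrank K ↥(LinearMap.ker X.mulVecLin ⊓ LinearMap.range Y.mulVecLin) =
      Y.rank := by
  have h := (X.mulVecLin.domRestrict (LinearMap.range Y.mulVecLin)).finrank_range_add_finrank_ker
  rwa [LinearMap.range_domRestrict, LinearMap.ker_domRestrict, ← LinearMap.range_comp,
    ← Matrix.mulVecLin_mul, ← Submodule.finrank_map_subtype_eq, Submodule.map_comap_subtype,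
    inf_comm] at h

theorem finrank_ker_inf_range_eq_zero_iff {X : Matrix m k K} {Y : Matrix k n K} :
    Module.finrank K ↥(LinearMap.ker X.mulVecLin ⊓ LinearMap.range Y.mulVecLin) = 0 ↔
      (X * Y).rank = Y.rank := by
  rw [← rank_mul_add_finrank_ker_inf_range X Y, left_eq_add]

theorem rank_mul_eq_right_of_rank_eq_card {X : Matrix m k K} (hX : X.rank = Fintype.card k)
    (Y : Matrix k n K) : (X * Y).rank = Y.rank := by
  have hker := X.mulVecLin.finrank_range_add_finrank_ker
  rw [Module.finrank_fintype_fun_eq_card, ← hX] at hker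
  have hbot : LinearMap.ker X.mulVecLin = ⊥ :=
    Submodule.finrank_eq_zero.1 (Nat.add_eq_left.1 hker)
  rw [← finrank_ker_inf_range_eq_zero_iff, hbot, bot_inf_eq, finrank_bot]

theorem exists_mul_mul_eq_left_of_rank_mul_eq {X : Matrix m k K} {Y : Matrix k n K}
    (h : (X * Y).rank = X.rank) : ∃ W : Matrix n k K, X * Y * W = X := by
  classical
  have hrange : LinearMap.range (X * Y).mulVecLin = LinearMap.range X.mulVecLin := by
    refine Submodule.eq_of_le_of_finrank_eq ?_ h
    rw [Matrix.mulVecLin_mul]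
    exact LinearMap.range_comp_le_range _ _
  have hcol (j : k) : ∃ w, (X * Y).mulVec w = X.mulVec (Pi.single j 1) := by
    have : X.mulVecLin (Pi.single j 1) ∈ LinearMap.range (X * Y).mulVecLin :=
      hrange ▸ LinearMap.mem_range_self _ _
    exact this
  choose w hw using hcol
  refine ⟨(Matrix.of w).transpose, ?_⟩
  ext i j
  have := congrFun (hw j) i
  rw [Matrix.mulVec_single_one] at this
  exact this

theorem exists_mul_mul_eq_right_of_rank_mul_eq [Fintype m] {X : Matrix m k K} {Y : Matrix k n K}
    (h : (X * Y).rank = Y.rank) : ∃ W : Matrix k m K, W * (X * Y) = Y := by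
  obtain ⟨W, hW⟩ := exists_mul_mul_eq_left_of_rank_mul_eq (X := Y.transpose) (Y := X.transpose)
    (by rw [← Matrix.transpose_mul, Matrix.rank_transpose, Matrix.rank_transpose, h])
  refine ⟨W.transpose, Matrix.transpose_injective ?_⟩
  rw [Matrix.transpose_mul, Matrix.transpose_mul, Matrix.transpose_transpose, hW]

theorem exists_factorization_through_rank [Fintype m] {X : Matrix m k K} {Y : Matrix k n K} {r : ℕ}
    (hX : X.rank = r) (hY : Y.rank = r) (hXY : (X * Y).rank = r) :
    ∃ (P : Matrix m (Fin r) K) (R : Matrix (Fin r) k K) (L : Matrix k (Fin r) K)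
      (Q : Matrix (Fin r) n K) (A : Matrix (Fin r) m K) (B : Matrix n (Fin r) K),
      P * R = X ∧ L * Q = Y ∧ R * L = 1 ∧ A * P = 1 ∧ Q * B = 1 := by
  classical
  obtain ⟨P, Q, A, B, hPQ, hAP, hQB⟩ := exists_rank_factorization hXY
  obtain ⟨U, hU⟩ := exists_mul_mul_eq_left_of_rank_mul_eq (hXY.trans hX.symm)
  obtain ⟨W, hW⟩ := exists_mul_mul_eq_right_of_rank_mul_eq (hXY.trans hY.symm)
  refine ⟨P, A * X, Y * B, Q, A, B, ?_, ?_, ?_, hAP, hQB⟩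
  · calc P * (A * X) = P * (A * P) * Q * U := by
          rw [← hU, ← hPQ]
          simp only [Matrix.mul_assoc]
      _ = X := by rw [hAP, Matrix.mul_one, hPQ, hU]
  · calc Y * B * Q = W * P * (Q * B) * Q := by
          rw [← hW, ← hPQ]
          simp only [Matrix.mul_assoc]
      _ = Y := by rw [hQB, Matrix.mul_one, Matrix.mul_assoc, hPQ, hW]
  · calc A * X * (Y * B) = A * (X * Y) * B := by simp only [Matrix.mul_assoc]
      _ = A * P * (Q * B) := by
          rw [← hPQ]
          simp only [Matrix.mul_assoc]
      _ = 1 := by rw [hAP, hQB, Matrix.one_mul]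

theorem rank_sub_mul_mul_add_card_le [Fintype m] [Fintype r] [DecidableEq r] {Z : Matrix m n K}
    {A : Matrix r m K} {B : Matrix n r K} (h : A * Z * B = 1) :
    (Z - Z * B * (A * Z)).rank + Fintype.card r ≤ Z.rank := by
  classical
  obtain ⟨s, hs⟩ : ∃ s, Z.rank = s := ⟨_, rfl⟩
  obtain ⟨P, Q, -, -, rfl, -, -⟩ := exists_rank_factorization hs
  have hAPQB : A * P * (Q * B) = 1 := by
    rw [← h]
    simp only [Matrix.mul_assoc]
  have hS : P * Q - P * Q * B * (A * (P * Q)) = P * (1 - Q * B * (A * P)) * Q := by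
    simp only [Matrix.mul_sub, Matrix.sub_mul, Matrix.mul_one, Matrix.mul_assoc]
  have hzero : A * P * (1 - Q * B * (A * P)) = 0 := by
    rw [Matrix.mul_sub, ← Matrix.mul_assoc, hAPQB, Matrix.mul_one, Matrix.one_mul, sub_self]
  have hr : Fintype.card r ≤ (A * P).rank := by
    rw [← Matrix.rank_one (R := K), ← hAPQB]
    exact Matrix.rank_mul_le_left _ _
  calc (P * Q - P * Q * B * (A * (P * Q))).rank + Fintype.card r
      ≤ (1 - Q * B * (A * P)).rank + (A * P).rank := by
        rw [hS]
        exact add_le_add ((Matrix.rank_mul_le_left _ _).trans (Matrix.rank_mul_le_right _ _)) hr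
    _ ≤ (P * Q).rank := by
        rw [hs, add_comm]
        simpa using Matrix.rank_add_rank_le_card_of_mul_eq_zero hzero

theorem exists_rank_add_left_eq_card_iff [Fintype m] (hkm : Fintype.card k ≤ Fintype.card m)
    {X : Matrix m k K} {Y : Matrix k n K} (hXY : X.rank = Y.rank) :
    (∃ V : Matrix m k K, V * Y = 0 ∧ (X + V).rank = Fintype.card k) ↔
      (X * Y).rank = Y.rank := by
  classical
  constructor
  · rintro ⟨V, hVY, hV⟩
    rw [← rank_mul_eq_right_of_rank_eq_card hV, Matrix.add_mul, hVY, add_zero]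
  intro h
  have hrk : X.rank ≤ Fintype.card k := X.rank_le_card_width
  obtain ⟨r, hr⟩ : ∃ r, X.rank = r := ⟨_, rfl⟩
  obtain ⟨q, hq⟩ := Nat.exists_eq_add_of_le (hr ▸ hrk)
  obtain ⟨P, R, L, Q, A, B, rfl, rfl, hRL, hAP, -⟩ :=
    exists_factorization_through_rank hr (hXY.symm.trans hr) ((h.trans hXY.symm).trans hr)
  obtain ⟨J, N, hNJ, hRJ, hNL⟩ :=
    exists_complementary_inverses (q := Fin q) hRL (by simp [hq])
  obtain ⟨T, S, hST, hAT, hSP⟩ :=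
    exists_complementary_inverses (q := Fin q) hAP (by simpa [← hq] using hkm)
  refine ⟨T * N, by rw [Matrix.mul_assoc, ← Matrix.mul_assoc N, hNL]; simp, ?_⟩
  have hone : Matrix.fromRows A S * ((P * R + T * N) * Matrix.fromCols L J) = 1 := by
    have hL : (P * R + T * N) * L = P := by simp [Matrix.add_mul, Matrix.mul_assoc, hRL, hNL]
    have hJ : (P * R + T * N) * J = T := by simp [Matrix.add_mul, Matrix.mul_assoc, hRJ, hNJ]
    rw [Matrix.mul_fromCols, hL, hJ, Matrix.fromRows_mul_fromCols, hAP, hAT, hSP, hST,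
      Matrix.fromBlocks_one]
  refine le_antisymm (Matrix.rank_le_card_width _) ?_
  calc Fintype.card k = (1 : Matrix (Fin r ⊕ Fin q) (Fin r ⊕ Fin q) K).rank := by simp [hq]
    _ ≤ (P * R + T * N).rank := by
        rw [← hone]
        exact (Matrix.rank_mul_le_right _ _).trans (Matrix.rank_mul_le_left _ _)

theorem exists_rank_add_right_eq_card_iff [Finite m]
    (hkn : Fintype.card k ≤ Fintype.card n) {X : Matrix m k K} {Y : Matrix k n K}
    (hXY : X.rank = Y.rank) :
    (∃ V : Matrix k n K, X * V = 0 ∧ (Y + V).rank = Fintype.card k) ↔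
      (X * Y).rank = X.rank := by
  have := Fintype.ofFinite m
  have h := exists_rank_add_left_eq_card_iff hkn (X := Y.transpose) (Y := X.transpose)
    (by rw [Matrix.rank_transpose, Matrix.rank_transpose, hXY])
  rw [← Matrix.transpose_mul, Matrix.rank_transpose, Matrix.rank_transpose] at h
  rw [← h]
  refine (Matrix.transposeAddEquiv k n K).toEquiv.exists_congr fun V => ?_
  simp [← Matrix.transpose_mul, ← Matrix.transpose_add]

end RankFactorization

section Openness

variable {X Y : Type*} [PseudoMetricSpace X] [PseudoMetricSpace Y] {F : X → Y} {R : Set Y} {w : X}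

/-- Local openness of order `p`: the image of the `ε`-ball contains, relative to `R`, a ball whose
radius is proportional to `ε ^ p`, for all small `ε`. Order one is linear openness. -/
def LocallyOpenOfOrder (F : X → Y) (R : Set Y) (w : X) (p : ℕ) : Prop :=
  ∃ c > 0, ∀ᶠ ε : ℝ in 𝓝[>] 0, CoversBall F R w ε (c * ε ^ p)

theorem CoversBall.mono {ε ε' δ δ' : ℝ} (h : CoversBall F R w ε δ) (hε : ε ≤ ε') (hδ : δ' ≤ δ) :
    CoversBall F R w ε' δ' :=
  ((Set.inter_subset_inter_left R (Metric.ball_subset_ball hδ)).trans h).trans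
    (Set.image_mono (Metric.ball_subset_ball hε))

theorem locallyOpenOfOrder_of_isBigO {p : ℕ} (hp : p ≠ 0) {g : Y → X}
    (hF : ∀ᶠ z in 𝓝[R] (F w), F (g z) = z)
    (hg : (fun z => dist (g z) w ^ p) =O[𝓝[R] (F w)] fun z => dist z (F w)) :
    LocallyOpenOfOrder F R w p := by
  obtain ⟨C, hC, hg⟩ := hg.exists_pos
  obtain ⟨η, hη, hball⟩ := Metric.mem_nhdsWithin_iff.1 (hF.and hg.bound)
  refine ⟨C⁻¹, inv_pos.2 hC, ?_⟩
  have hsmall : Tendsto (fun ε : ℝ => C⁻¹ * ε ^ p) (𝓝[>] 0) (𝓝 0) := by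
    have : Continuous fun ε : ℝ => C⁻¹ * ε ^ p := by fun_prop
    simpa [hp] using (this.tendsto 0).mono_left nhdsWithin_le_nhds
  filter_upwards [hsmall.eventually_lt_const hη, self_mem_nhdsWithin] with ε hεη hε
  rintro z ⟨hz, hzR⟩
  obtain ⟨hFz, hgz⟩ := hball ⟨hz.trans hεη, hzR⟩
  rw [Real.norm_of_nonneg (by positivity), Real.norm_of_nonneg dist_nonneg] at hgz
  have hpow : dist (g z) w ^ p < ε ^ p := hgz.trans_lt ((lt_inv_mul_iff₀ hC).1 hz)
  exact ⟨g z, lt_of_pow_lt_pow_left₀ p (le_of_lt hε) hpow, hFz⟩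

theorem LocallyOpenOfOrder.exists_isTheta {p : ℕ} (h : LocallyOpenOfOrder F R w p) :
    ∃ δ : ℝ → ℝ, (∀ ε, 0 < ε → 0 < δ ε ∧ CoversBall F R w ε (δ ε)) ∧
      δ =Θ[𝓝[>] 0] fun ε => ε ^ p := by
  obtain ⟨c, hc, h⟩ := h
  obtain ⟨ε₀, hε₀, hcov⟩ := mem_nhdsGT_iff_exists_Ioc_subset.1 h
  refine ⟨fun ε => c * min ε ε₀ ^ p, fun ε hε => ?_, ?_⟩
  · have hmin : 0 < min ε ε₀ := lt_min hε hε₀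
    exact ⟨by positivity, (hcov ⟨hmin, min_le_right _ _⟩).mono (min_le_left _ _) le_rfl⟩
  · refine (isTheta_const_mul_left hc.ne').2 (EventuallyEq.isTheta ?_)
    filter_upwards [Ioc_mem_nhdsGT hε₀] with ε hε
    rw [min_eq_left hε.2]

theorem LocallyOpenOfOrder.locallyOpenAtIn {p : ℕ} (h : LocallyOpenOfOrder F R w p) :
    LocallyOpenAtIn F R w :=
  have ⟨δ, hδ, _⟩ := h.exists_isTheta
  fun ε hε => ⟨δ ε, hδ ε hε⟩

theorem LocallyOpenAtIn.mem_closure_preimage (h : LocallyOpenAtIn F R w) {S : Set Y} (hS : S ⊆ R)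
    (hw : F w ∈ closure S) : w ∈ closure (F ⁻¹' S) := by
  refine Metric.mem_closure_iff.2 fun ε hε => ?_
  obtain ⟨δ, hδ, hcov⟩ := h ε hε
  obtain ⟨z, hz, hzw⟩ := Metric.mem_closure_iff.1 hw δ hδ
  obtain ⟨w', hw', rfl⟩ := hcov ⟨by rwa [Metric.mem_ball'], hS hz⟩
  exact ⟨w', hz, by rwa [Metric.mem_ball'] at hw'⟩

end Openness

section LocalFactorization

open Matrix

variable {𝕜 : Type*} [RCLike 𝕜] {m n k q r : Type*} [Fintype m] [Fintype n] [Fintype k]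

theorem isBigO_matrix_mul {α : Type*} {l : Filter α} {f : α → Matrix m k 𝕜} {g : α → Matrix k n 𝕜}
    {u v : α → ℝ} (hf : f =O[l] u) (hg : g =O[l] v) :
    (fun x => f x * g x) =O[l] fun x => u x * v x :=
  (IsBigO.of_norm_le fun x => Matrix.frobenius_norm_mul (f x) (g x)).trans
    (hf.norm_left.mul hg.norm_left)

theorem isBigO_const_matrix_mul {α : Type*} {l : Filter α} (M : Matrix m k 𝕜)
    {f : α → Matrix k n 𝕜} {u : α → ℝ} (hf : f =O[l] u) : (fun x => M * f x) =O[l] u := by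
  simpa using isBigO_matrix_mul (isBigO_const_const M one_ne_zero l) hf

theorem isBigO_matrix_mul_const {α : Type*} {l : Filter α} {f : α → Matrix m k 𝕜}
    (M : Matrix k n 𝕜) {u : α → ℝ} (hf : f =O[l] u) : (fun x => f x * M) =O[l] u := by
  simpa using isBigO_matrix_mul hf (isBigO_const_const M one_ne_zero l)

theorem isBigO_sqrt_norm_sub {E : Type*} [SeminormedAddCommGroup E] (a : E) :
    (fun x => ‖x - a‖) =O[𝓝 a] fun x => √‖x - a‖ := by
  refine IsBigO.of_norm_eventuallyLE ?_
  filter_upwards [Metric.ball_mem_nhds a one_pos] with x hx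
  rw [norm_norm]
  refine Real.le_sqrt_of_sq_le (pow_le_of_le_one (norm_nonneg _) ?_ two_ne_zero)
  exact (mem_ball_iff_norm.1 hx).le

theorem exists_continuousAt_mul_mul_eq_one [Finite r] [DecidableEq r] {A : Matrix r m 𝕜}
    {M : Matrix m n 𝕜} {B : Matrix n r 𝕜} (h : A * M * B = 1) :
    ∃ B' : Matrix m n 𝕜 → Matrix n r 𝕜, ContinuousAt B' M ∧ ∀ᶠ Z in 𝓝 M, A * Z * B' Z = 1 := by
  have := Fintype.ofFinite r
  have hAZB : Continuous fun Z : Matrix m n 𝕜 => A * Z * B := by fun_prop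
  refine ⟨fun Z => B * (A * Z * B)⁻¹, ?_, ?_⟩
  · have hinv : ContinuousAt Inv.inv (A * M * B) := continuousAt_matrix_inv _ <| by
      rw [h, Matrix.det_one]
      exact NormedRing.inverse_continuousAt (1 : 𝕜ˣ)
    have hB : Continuous fun N : Matrix r r 𝕜 => B * N := by fun_prop
    exact hB.continuousAt.comp (hinv.comp (f := fun Z => A * Z * B) hAZB.continuousAt)
  · have hdet : ∀ᶠ Z in 𝓝 M, (A * Z * B).det ≠ 0 :=
      hAZB.matrix_det.continuousAt.eventually_ne (by simp [h])
    filter_upwards [hdet] with Z hZ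
    rw [← Matrix.mul_assoc, Matrix.mul_nonsing_inv _ (isUnit_iff_ne_zero.2 hZ)]

theorem exists_isBigO_sub_rank_sub_add_card_le [Fintype r] [DecidableEq r] {P : Matrix m r 𝕜}
    {Q : Matrix r n 𝕜} {A : Matrix r m 𝕜} {B : Matrix n r 𝕜} (hAP : A * P = 1) (hQB : Q * B = 1) :
    ∃ (P' : Matrix m n 𝕜 → Matrix m r 𝕜) (Q' : Matrix m n 𝕜 → Matrix r n 𝕜),
      (fun Z => P' Z - P) =O[𝓝 (P * Q)] (fun Z => ‖Z - P * Q‖) ∧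
      (fun Z => Q' Z - Q) =O[𝓝 (P * Q)] (fun Z => ‖Z - P * Q‖) ∧
      (fun Z => Z - P' Z * Q' Z) =O[𝓝 (P * Q)] (fun Z => ‖Z - P * Q‖) ∧
      ∀ᶠ Z in 𝓝 (P * Q), (Z - P' Z * Q' Z).rank + Fintype.card r ≤ Z.rank := by
  classical
  have hAPQ : A * (P * Q) = Q := by rw [← Matrix.mul_assoc, hAP, Matrix.one_mul]
  obtain ⟨B', hB'_cont, hB'⟩ :=
    exists_continuousAt_mul_mul_eq_one (M := P * Q) (by rw [hAPQ, hQB])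
  have hAZ : (fun Z : Matrix m n 𝕜 => A * Z) =O[𝓝 (P * Q)] fun _ => (1 : ℝ) :=
    Tendsto.isBigO_one ℝ (Continuous.tendsto (by fun_prop) (P * Q))
  have hD : (fun Z => Z - P * Q) =O[𝓝 (P * Q)] fun Z => ‖Z - P * Q‖ := (isBigO_refl _ _).norm_right
  have hproj : (fun Z => Z - P * (A * Z)) =O[𝓝 (P * Q)] fun Z => ‖Z - P * Q‖ :=
    (isBigO_const_matrix_mul (1 - P * A) hD).congr_left fun Z => by
      simp [Matrix.sub_mul, Matrix.mul_sub, Matrix.mul_assoc, hAPQ]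
  have hP' : (fun Z => Z * B' Z - P) =O[𝓝 (P * Q)] fun Z => ‖Z - P * Q‖ := by
    have h := isBigO_matrix_mul hproj (hB'_cont.isBigO_one ℝ)
    simp only [mul_one] at h
    refine h.congr' ?_ EventuallyEq.rfl
    filter_upwards [hB'] with Z hZ
    rw [Matrix.sub_mul, Matrix.mul_assoc P, hZ, Matrix.mul_one]
  refine ⟨fun Z => Z * B' Z, fun Z => A * Z, hP', ?_, ?_, ?_⟩
  · exact (isBigO_const_matrix_mul A hD).congr_left fun Z => by rw [Matrix.mul_sub, hAPQ]
  · have h := isBigO_matrix_mul hP' hAZ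
    simp only [mul_one] at h
    exact (hproj.sub h).congr_left fun Z => by rw [Matrix.sub_mul, sub_sub_sub_cancel_right]
  · filter_upwards [hB'] with Z hZ
    exact rank_sub_mul_mul_add_card_le hZ

end LocalFactorization

section BoundedFactorization

open Matrix

attribute [local instance] Matrix.frobeniusNormedSpace

variable {𝕜 : Type*} [RCLike 𝕜] {m n q r : Type*} [Fintype m] [Fintype n] [Fintype q] [Fintype r]

theorem norm_eq_sqrt_card_of_conjTranspose_mul_self_eq_one [DecidableEq r] {U : Matrix m r 𝕜}
    (h : Uᴴ * U = 1) : ‖U‖ = √(Fintype.card r) := by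
  have hcol (j : r) : ∑ i, ‖U i j‖ ^ 2 = 1 := by
    have := congrFun (congrFun h j) j
    rw [Matrix.mul_apply, Matrix.one_apply_eq] at this
    simp only [conjTranspose_apply, RCLike.star_def, RCLike.conj_mul] at this
    exact_mod_cast this
  have hsum : ∑ i, ∑ j, ‖U i j‖ ^ (2 : ℝ) = Fintype.card r := by
    rw [Finset.sum_comm]
    simp [hcol]
  rw [frobenius_norm_def, hsum, Real.sqrt_eq_rpow]

theorem exists_conjTranspose_mul_self_eq_one_mul_mul_eq {S : Matrix m n 𝕜} {r : ℕ}
    (hr : S.rank = r) : ∃ U : Matrix m (Fin r) 𝕜, Uᴴ * U = 1 ∧ U * (Uᴴ * S) = S := by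
  classical
  let W := LinearMap.range (toLpLin 2 2 S)
  have hW : Module.finrank 𝕜 W = r := by
    rw [← hr, rank_eq_finrank_range_toLin S (PiLp.basisFun 2 𝕜 m) (PiLp.basisFun 2 𝕜 n),
      ← toLpLin_eq_toLin]
  let b : OrthonormalBasis (Fin r) 𝕜 W := (stdOrthonormalBasis 𝕜 W).reindex (finCongr hW)
  let U : Matrix m (Fin r) 𝕜 := Matrix.of fun i j => (b j : EuclideanSpace 𝕜 m) i
  refine ⟨U, ?_, ?_⟩
  · ext i j
    have := orthonormal_iff_ite.1 b.orthonormal i j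
    rw [Matrix.one_apply, ← this]
    simp [Matrix.mul_apply, U, PiLp.inner_apply, mul_comm]
  · ext i j
    have := congrArg (fun x : W => (x : EuclideanSpace 𝕜 m) i)
      (b.sum_repr' ⟨toLpLin 2 2 S (EuclideanSpace.single j 1), LinearMap.mem_range_self _ _⟩)
    simpa [Matrix.mul_apply, U, PiLp.inner_apply, mul_comm] using this

theorem exists_mul_eq_norm_le_sqrt_norm {S : Matrix m n 𝕜} (hS : S.rank ≤ Fintype.card q) :
    ∃ (T : Matrix m q 𝕜) (V : Matrix q n 𝕜), T * V = S ∧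
      ‖T‖ ≤ Fintype.card q * √‖S‖ ∧ ‖V‖ ≤ Fintype.card q * √‖S‖ := by
  classical
  obtain rfl | hS₀ := eq_or_ne S 0
  · exact ⟨0, 0, by simp⟩
  obtain ⟨r, hr⟩ : ∃ r, S.rank = r := ⟨_, rfl⟩
  obtain ⟨U, hU, hUS⟩ := exists_conjTranspose_mul_self_eq_one_mul_mul_eq hr
  obtain ⟨e⟩ : Nonempty (Fin r ↪ q) := Function.Embedding.nonempty_of_card_le (by simpa [← hr])
  let E : Matrix q (Fin r) 𝕜 := (1 : Matrix q q 𝕜).submatrix id e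
  have hE : Eᴴ * E = 1 := by
    rw [conjTranspose_submatrix, conjTranspose_one,
      ← Matrix.submatrix_mul _ _ _ _ _ Function.bijective_id, Matrix.one_mul,
      submatrix_one_embedding]
  have hUE : ‖U * Eᴴ‖ ≤ Fintype.card q := by
    calc ‖U * Eᴴ‖ ≤ ‖U‖ * ‖Eᴴ‖ := frobenius_norm_mul _ _
      _ = r := by
        rw [frobenius_norm_conjTranspose, norm_eq_sqrt_card_of_conjTranspose_mul_self_eq_one hU,
          norm_eq_sqrt_card_of_conjTranspose_mul_self_eq_one hE]
        simp
      _ ≤ Fintype.card q := by exact_mod_cast hr ▸ hS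
  have ht : √‖S‖ ≠ 0 := (Real.sqrt_pos.2 (norm_pos_iff.2 hS₀)).ne'
  refine ⟨√‖S‖ • (U * Eᴴ), (√‖S‖)⁻¹ • ((U * Eᴴ)ᴴ * S), ?_, ?_, ?_⟩
  · have hE' : E * Uᴴ * S = E * (Uᴴ * S) := Matrix.mul_assoc _ _ _
    rw [Matrix.smul_mul, Matrix.mul_smul, smul_smul, mul_inv_cancel₀ ht, one_smul,
      conjTranspose_mul, conjTranspose_conjTranspose, Matrix.mul_assoc, hE', ← Matrix.mul_assoc Eᴴ,
      hE, Matrix.one_mul, hUS]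
  · rw [norm_smul, Real.norm_of_nonneg (Real.sqrt_nonneg _), mul_comm]
    gcongr
  · rw [norm_smul, norm_inv, Real.norm_of_nonneg (Real.sqrt_nonneg _),
      inv_mul_le_iff₀ (by positivity)]
    calc ‖(U * Eᴴ)ᴴ * S‖ ≤ ‖(U * Eᴴ)ᴴ‖ * ‖S‖ := frobenius_norm_mul _ _
      _ ≤ Fintype.card q * ‖S‖ := by rw [frobenius_norm_conjTranspose]; gcongr
      _ = √‖S‖ * (Fintype.card q * √‖S‖) := by
        rw [mul_left_comm, Real.mul_self_sqrt (norm_nonneg S)]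

theorem exists_isBigO_sqrt_norm_mul_eq {α : Type*} {l : Filter α} {S : α → Matrix m n 𝕜}
    (hS : ∀ᶠ x in l, (S x).rank ≤ Fintype.card q) :
    ∃ (T : α → Matrix m q 𝕜) (V : α → Matrix q n 𝕜), (∀ᶠ x in l, T x * V x = S x) ∧
      T =O[l] (fun x => √‖S x‖) ∧ V =O[l] fun x => √‖S x‖ := by
  choose! T V hTV hT hV using
    fun M : Matrix m n 𝕜 => exists_mul_eq_norm_le_sqrt_norm (S := M) (q := q)
  refine ⟨fun x => T (S x), fun x => V (S x), hS.mono fun x hx => hTV _ hx,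
    IsBigO.of_bound (Fintype.card q) ?_, IsBigO.of_bound (Fintype.card q) ?_⟩
  · filter_upwards [hS] with x hx
    simpa [abs_of_nonneg] using hT _ hx
  · filter_upwards [hS] with x hx
    simpa [abs_of_nonneg] using hV _ hx

end BoundedFactorization

/-- The matrix product as a map on pairs of factors, with arbitrary entries and index types.
Over `ℝ` and with index types `Fin _` this is `matMul`. -/
def matrixMul (R m k n : Type*) [NonUnitalNonAssocSemiring R] [Fintype k] :
    Matrix m k R × Matrix k n R → Matrix m n R :=
  fun W => W.1 * W.2

theorem matrixMul_mul_mul {K m n k r : Type*} [Semiring K] [Fintype k] [Fintype r] [DecidableEq r]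
    {R : Matrix r k K} {L : Matrix k r K} (hRL : R * L = 1) (P : Matrix m r K) (Q : Matrix r n K) :
    matrixMul K m k n (P * R, L * Q) = P * Q := by
  rw [matrixMul, Matrix.mul_assoc, ← Matrix.mul_assoc R, hRL, Matrix.one_mul]

theorem matrixMul_real_fin (m k n : ℕ) : matrixMul ℝ (Fin m) (Fin k) (Fin n) = matMul m k n :=
  rfl

section MatrixMul

open Matrix

variable {𝕜 : Type*} [RCLike 𝕜] {m n k : Type*} [Fintype n] [Fintype k]

theorem rank_le_card_of_mem_range_matrixMul {Z : Matrix m n 𝕜}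
    (hZ : Z ∈ Set.range (matrixMul 𝕜 m k n)) : Z.rank ≤ Fintype.card k := by
  obtain ⟨W, rfl⟩ := hZ
  exact (rank_mul_le_left _ _).trans (rank_le_card_width _)

theorem locallyOpenOfOrder_one_matrixMul [Fintype m] {X : Matrix m k 𝕜} {Y : Matrix k n 𝕜}
    (hX : X.rank = Fintype.card k) (hY : Y.rank = Fintype.card k) :
    LocallyOpenOfOrder (matrixMul 𝕜 m k n) (Set.range (matrixMul 𝕜 m k n)) (X, Y) 1 := by
  obtain ⟨P, R, L, Q, A, B, rfl, rfl, hRL, hAP, hQB⟩ :=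
    exists_factorization_through_rank hX hY ((rank_mul_eq_right_of_rank_eq_card hX Y).trans hY)
  obtain ⟨P', Q', hP', hQ', -, hrank⟩ := exists_isBigO_sub_rank_sub_add_card_le hAP hQB
  refine locallyOpenOfOrder_of_isBigO one_ne_zero (g := fun Z => (P' Z * R, L * Q' Z)) ?_ ?_
  · rw [matrixMul_mul_mul hRL]
    filter_upwards [hrank.filter_mono nhdsWithin_le_nhds, self_mem_nhdsWithin] with Z hZ hZk
    have hrank₀ : (Z - P' Z * Q' Z).rank = 0 := by
      have := rank_le_card_of_mem_range_matrixMul hZk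
      rw [Fintype.card_fin] at hZ
      omega
    obtain ⟨T, V, -, -, hTV, -, -⟩ := exists_rank_factorization hrank₀
    have hZ₀ : P' Z * Q' Z = Z := by
      rw [← sub_eq_zero, ← neg_sub, ← hTV, neg_eq_zero]
      ext
      simp [Matrix.mul_apply]
    rw [matrixMul_mul_mul hRL, hZ₀]
  · simp only [matrixMul_mul_mul hRL, pow_one, dist_eq_norm]
    refine IsBigO.norm_left (IsBigO.mono (IsBigO.prod_left ?_ ?_) nhdsWithin_le_nhds)
    · exact (isBigO_matrix_mul_const R hP').congr_left fun Z => Matrix.sub_mul _ _ _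
    · exact (isBigO_const_matrix_mul L hQ').congr_left fun Z => Matrix.mul_sub _ _ _

theorem locallyOpenOfOrder_two_matrixMul [Fintype m] {X : Matrix m k 𝕜} {Y : Matrix k n 𝕜}
    (hX : (X * Y).rank = X.rank) (hY : (X * Y).rank = Y.rank) :
    LocallyOpenOfOrder (matrixMul 𝕜 m k n) (Set.range (matrixMul 𝕜 m k n)) (X, Y) 2 := by
  have hrk : X.rank ≤ Fintype.card k := X.rank_le_card_width
  obtain ⟨r, hr⟩ : ∃ r, X.rank = r := ⟨_, rfl⟩
  obtain ⟨q, hq⟩ := Nat.exists_eq_add_of_le (hr ▸ hrk)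
  obtain ⟨P, R, L, Q, A, B, rfl, rfl, hRL, hAP, hQB⟩ :=
    exists_factorization_through_rank hr (hY.symm.trans (hX.trans hr)) (hX.trans hr)
  obtain ⟨J, N, hNJ, hRJ, hNL⟩ :=
    exists_complementary_inverses (q := Fin q) hRL (by simp [hq])
  obtain ⟨P', Q', hP', hQ', hS, hrank⟩ := exists_isBigO_sub_rank_sub_add_card_le hAP hQB
  have hcard : ∀ᶠ Z in 𝓝[Set.range (matrixMul 𝕜 m k n)] (P * Q),
      (Z - P' Z * Q' Z).rank ≤ Fintype.card (Fin q) := by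
    filter_upwards [hrank.filter_mono nhdsWithin_le_nhds, self_mem_nhdsWithin] with Z hZ hZk
    have := rank_le_card_of_mem_range_matrixMul hZk
    simp only [Fintype.card_fin] at hZ ⊢
    omega
  obtain ⟨T, V, hTV, hT, hV⟩ := exists_isBigO_sqrt_norm_mul_eq hcard
  refine locallyOpenOfOrder_of_isBigO two_ne_zero
    (g := fun Z => (P' Z * R + T Z * N, L * Q' Z + J * V Z)) ?_ ?_
  · rw [matrixMul_mul_mul hRL]
    filter_upwards [hTV] with Z hZ
    rw [matrixMul, add_mul_add_of_complementary hRL hNJ hRJ hNL, hZ, add_sub_cancel]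
  simp only [matrixMul_mul_mul hRL, dist_eq_norm]
  have hsqrt : (fun Z => √‖Z - P' Z * Q' Z‖) =O[𝓝 (P * Q)] fun Z => √‖Z - P * Q‖ :=
    hS.norm_left.sqrt (Eventually.of_forall fun _ => norm_nonneg _)
  have hX' : (fun Z => P' Z * R + T Z * N - P * R)
      =O[𝓝[Set.range (matrixMul 𝕜 m k n)] (P * Q)] fun Z => √‖Z - P * Q‖ :=
    ((isBigO_matrix_mul_const R ((hP'.trans (isBigO_sqrt_norm_sub _)).mono nhdsWithin_le_nhds)).add
      (isBigO_matrix_mul_const N (hT.trans (hsqrt.mono nhdsWithin_le_nhds)))).congr_left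
      fun Z => by rw [Matrix.sub_mul]; abel
  have hY' : (fun Z => L * Q' Z + J * V Z - L * Q)
      =O[𝓝[Set.range (matrixMul 𝕜 m k n)] (P * Q)] fun Z => √‖Z - P * Q‖ :=
    ((isBigO_const_matrix_mul L ((hQ'.trans (isBigO_sqrt_norm_sub _)).mono nhdsWithin_le_nhds)).add
      (isBigO_const_matrix_mul J (hV.trans (hsqrt.mono nhdsWithin_le_nhds)))).congr_left
      fun Z => by rw [Matrix.mul_sub]; abel
  exact ((hX'.prod_left hY').norm_left.pow 2).congr_right fun Z => Real.sq_sqrt (norm_nonneg _)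

end MatrixMul

section Necessity

theorem eventually_isUnit_add_smul_one {K k : Type*} [Field K] [TopologicalSpace K] [T1Space K]
    [Fintype k] [DecidableEq k] (M : Matrix k k K) :
    ∀ᶠ c : K in 𝓝[≠] 0, IsUnit (M + c • (1 : Matrix k k K)) := by
  filter_upwards [nhdsNE_le_cofinite 0 (Matrix.finite_spectrum (-M)).compl_mem_cofinite] with c hc
  rwa [Set.mem_compl_iff, spectrum.notMem_iff, sub_neg_eq_add, Algebra.algebraMap_eq_smul_one,
    add_comm] at hc

theorem mul_eq_zero_of_isUnit_mul_mul {R k l m n : Type*} [CommRing R] [Fintype k] [Fintype m]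
    [Fintype n] [DecidableEq k] {C : Matrix k m R} {X : Matrix m k R} {Y : Matrix k n R}
    {T : Matrix n k R} {v : Matrix n l R} (h : IsUnit (C * (X * Y) * T))
    (hv : X * Y * v = 0) : Y * v = 0 := by
  have hCX : IsUnit (C * X) := by
    rw [← Matrix.mul_assoc C, Matrix.mul_assoc (C * X)] at h
    exact isUnit_of_mul_isUnit_left h
  obtain ⟨D, hD⟩ := hCX.exists_left_inv
  calc Y * v = D * (C * X) * (Y * v) := by rw [hD, Matrix.one_mul]
    _ = D * (C * (X * Y * v)) := by simp only [Matrix.mul_assoc]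
    _ = 0 := by rw [hv, Matrix.mul_zero, Matrix.mul_zero]

theorem dist_matrix_transpose {α m n : Type*} [NormedAddCommGroup α] [Fintype m] [Fintype n]
    (M N : Matrix m n α) : dist M.transpose N.transpose = dist M N := by
  rw [dist_eq_norm, dist_eq_norm, ← Matrix.transpose_sub, Matrix.frobenius_norm_transpose]

variable {𝕜 : Type*} [RCLike 𝕜] {m n k l : Type*} [Fintype m] [Fintype n] [Fintype k]

theorem exists_mem_closure_isUnit_mul_mul [Fintype l] [DecidableEq l] [DecidableEq k]
    (hkm : Fintype.card k ≤ Fintype.card m)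
    (hkn : Fintype.card l + Fintype.card k ≤ Fintype.card n) {X : Matrix m k 𝕜} {Y : Matrix k n 𝕜}
    {φ : Matrix l n 𝕜} {v : Matrix n l 𝕜} (hφ : φ * v = 1) (hv : X * Y * v = 0) :
    ∃ (C : Matrix k m 𝕜) (T : Matrix n k 𝕜), X * Y ∈ closure {Z : Matrix m n 𝕜 |
      Z ∈ Set.range (matrixMul 𝕜 m k n) ∧ Z * v = 0 ∧ IsUnit (C * Z * T)} := by
  obtain ⟨T, F, hFT, -, hFv⟩ := exists_complementary_inverses (q := k) hφ hkn
  obtain ⟨V, C, hCV, -, -⟩ := exists_complementary_inverses (q := k)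
    (A := (0 : Matrix (Fin 0) m 𝕜)) (P := 0) (Subsingleton.elim _ _) (by simpa)
  -- Replacing `Y` by `G` before perturbing the factors keeps `v` in the kernel of their product.
  let G := Y - Y * v * φ
  have hXG : X * G = X * Y := by
    rw [Matrix.mul_sub, ← Matrix.mul_assoc, ← Matrix.mul_assoc, hv, Matrix.zero_mul, sub_zero]
  have hGv : G * v = 0 := by
    rw [Matrix.sub_mul, Matrix.mul_assoc _ φ, hφ, Matrix.mul_one, sub_self]
  let Z (c : 𝕜) := (X + c • V) * (G + c • F)
  have hZ : Tendsto Z (𝓝[≠] 0) (𝓝 (X * Y)) := by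
    have hcont : Continuous Z := by fun_prop
    simpa [Z, hXG] using (hcont.tendsto 0).mono_left nhdsWithin_le_nhds
  refine ⟨C, T, mem_closure_of_tendsto hZ ?_⟩
  filter_upwards [eventually_isUnit_add_smul_one (C * X), eventually_isUnit_add_smul_one (G * T)]
    with c hCX hGT
  refine ⟨⟨(_, _), rfl⟩, ?_, ?_⟩
  · simp [Z, Matrix.mul_assoc, Matrix.add_mul, hGv, hFv]
  · have hCZT : C * Z c * T = (C * X + c • 1) * (G * T + c • 1) := by
      nth_rw 1 [← hCV]
      rw [← hFT]
      simp only [Z, Matrix.mul_assoc, Matrix.add_mul, Matrix.mul_add, Matrix.smul_mul,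
        Matrix.mul_smul]
    rw [hCZT]
    exact hCX.mul hGT

theorem mul_eq_zero_of_locallyOpenAtIn_matrixMul [Fintype l] [DecidableEq l]
    (hkm : Fintype.card k ≤ Fintype.card m)
    (hkn : Fintype.card l + Fintype.card k ≤ Fintype.card n) {X : Matrix m k 𝕜} {Y : Matrix k n 𝕜}
    (h : LocallyOpenAtIn (matrixMul 𝕜 m k n) (Set.range (matrixMul 𝕜 m k n)) (X, Y))
    {φ : Matrix l n 𝕜} {v : Matrix n l 𝕜} (hφ : φ * v = 1) (hv : X * Y * v = 0) : Y * v = 0 := by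
  classical
  obtain ⟨C, T, hXY⟩ := exists_mem_closure_isUnit_mul_mul hkm hkn hφ hv
  have hclosed : IsClosed {W : Matrix m k 𝕜 × Matrix k n 𝕜 | W.2 * v = 0} :=
    isClosed_eq (by fun_prop) continuous_const
  refine closure_minimal ?_ hclosed (h.mem_closure_preimage (fun Z hZ => hZ.1) hXY)
  exact fun W ⟨_, hWv, hW⟩ => mul_eq_zero_of_isUnit_mul_mul hW hWv

theorem rank_mul_eq_right_of_locallyOpenAtIn_matrixMul (hkm : Fintype.card k ≤ Fintype.card m)
    (hkn : Fintype.card k < Fintype.card n) {X : Matrix m k 𝕜} {Y : Matrix k n 𝕜}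
    (h : LocallyOpenAtIn (matrixMul 𝕜 m k n) (Set.range (matrixMul 𝕜 m k n)) (X, Y)) :
    (X * Y).rank = Y.rank := by
  classical
  rw [← finrank_ker_inf_range_eq_zero_iff, Submodule.finrank_eq_zero, Submodule.eq_bot_iff]
  rintro _ ⟨hXYv, v, rfl⟩
  obtain rfl | hv₀ := eq_or_ne v 0
  · exact map_zero _
  obtain ⟨i, hi⟩ := Function.ne_iff.1 hv₀
  have hφ : Matrix.replicateRow Unit (Pi.single i (v i)⁻¹) * Matrix.replicateCol Unit v = 1 := by
    ext
    simpa [Matrix.mul_apply, Pi.single_apply] using inv_mul_cancel₀ hi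
  have hXY : X * Y * Matrix.replicateCol Unit v = 0 := by
    rw [← Matrix.replicateCol_mulVec, ← Matrix.mulVec_mulVec]
    exact (Matrix.replicateCol_eq_zero _).2 hXYv
  have := mul_eq_zero_of_locallyOpenAtIn_matrixMul hkm (by simpa [add_comm] using hkn) h hφ hXY
  rwa [← Matrix.replicateCol_mulVec, Matrix.replicateCol_eq_zero] at this

theorem LocallyOpenAtIn.matrixMul_transpose {X : Matrix m k 𝕜} {Y : Matrix k n 𝕜}
    (h : LocallyOpenAtIn (matrixMul 𝕜 m k n) (Set.range (matrixMul 𝕜 m k n)) (X, Y)) :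
    LocallyOpenAtIn (matrixMul 𝕜 n k m) (Set.range (matrixMul 𝕜 n k m))
      (Y.transpose, X.transpose) := by
  have hmul (X' : Matrix m k 𝕜) (Y' : Matrix k n 𝕜) :
      matrixMul 𝕜 n k m (Y'.transpose, X'.transpose) = (matrixMul 𝕜 m k n (X', Y')).transpose :=
    (Matrix.transpose_mul _ _).symm
  intro ε hε
  obtain ⟨δ, hδ, hcov⟩ := h ε hε
  refine ⟨δ, hδ, ?_⟩
  rintro _ ⟨hZ, ⟨W₁, W₂⟩, rfl⟩
  rw [← W₁.transpose_transpose, ← W₂.transpose_transpose, hmul] at hZ ⊢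
  rw [hmul, Metric.mem_ball, dist_matrix_transpose] at hZ
  obtain ⟨⟨X', Y'⟩, hXY, hW⟩ := hcov ⟨hZ, Set.mem_range_self _⟩
  refine ⟨(Y'.transpose, X'.transpose), ?_, by rw [hmul, hW]⟩
  rw [Metric.mem_ball, Prod.dist_eq] at hXY ⊢
  rwa [dist_matrix_transpose, dist_matrix_transpose, max_comm]

theorem rank_mul_eq_left_of_locallyOpenAtIn_matrixMul (hkm : Fintype.card k < Fintype.card m)
    (hkn : Fintype.card k ≤ Fintype.card n) {X : Matrix m k 𝕜} {Y : Matrix k n 𝕜}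
    (h : LocallyOpenAtIn (matrixMul 𝕜 m k n) (Set.range (matrixMul 𝕜 m k n)) (X, Y)) :
    (X * Y).rank = X.rank := by
  have := rank_mul_eq_right_of_locallyOpenAtIn_matrixMul hkn hkm h.matrixMul_transpose
  rwa [← Matrix.transpose_mul, Matrix.rank_transpose, Matrix.rank_transpose] at this

end Necessity

section Characterization

variable {𝕜 : Type*} [RCLike 𝕜] {m n k : Type*} [Fintype m] [Fintype n] [Fintype k]

theorem locallyOpenAtIn_matrixMul_iff (hkm : Fintype.card k < Fintype.card m)
    (hkn : Fintype.card k < Fintype.card n) {X : Matrix m k 𝕜} {Y : Matrix k n 𝕜} :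
    LocallyOpenAtIn (matrixMul 𝕜 m k n) (Set.range (matrixMul 𝕜 m k n)) (X, Y) ↔
      (X * Y).rank = X.rank ∧ (X * Y).rank = Y.rank :=
  ⟨fun h => ⟨rank_mul_eq_left_of_locallyOpenAtIn_matrixMul hkm hkn.le h,
    rank_mul_eq_right_of_locallyOpenAtIn_matrixMul hkm.le hkn h⟩,
    fun h => (locallyOpenOfOrder_two_matrixMul h.1 h.2).locallyOpenAtIn⟩

end Characterization

theorem theorem1_general {𝕜 : Type*} [RCLike 𝕜] {m n k : Type*} [Fintype m] [Fintype n]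
    [Fintype k] (hk : Fintype.card k < min (Fintype.card m) (Fintype.card n))
    (X : Matrix m k 𝕜) (Y : Matrix k n 𝕜) :
    (X.rank ≠ Y.rank →
      ¬ LocallyOpenAtIn (matrixMul 𝕜 m k n) (Set.range (matrixMul 𝕜 m k n)) (X, Y)) ∧
    (X.rank = Y.rank →
      List.TFAE [
        ∃ V : Matrix m k 𝕜, V * Y = 0 ∧ (X + V).rank = Fintype.card k,
        ∃ V : Matrix k n 𝕜, X * V = 0 ∧ (Y + V).rank = Fintype.card k,
        Module.finrank 𝕜 ↥(LinearMap.ker X.mulVecLin ⊓ LinearMap.range Y.mulVecLin) = 0,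
        Module.finrank 𝕜 ↥(LinearMap.ker Y.transpose.mulVecLin ⊓
          LinearMap.range X.transpose.mulVecLin) = 0,
        LocallyOpenAtIn (matrixMul 𝕜 m k n) (Set.range (matrixMul 𝕜 m k n)) (X, Y)]) ∧
    (LocallyOpenAtIn (matrixMul 𝕜 m k n) (Set.range (matrixMul 𝕜 m k n)) (X, Y) →
      ∃ δ : ℝ → ℝ,
        (∀ ε : ℝ, 0 < ε → 0 < δ ε ∧
          CoversBall (matrixMul 𝕜 m k n) (Set.range (matrixMul 𝕜 m k n)) (X, Y) ε (δ ε)) ∧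
        δ =O[𝓝[>] 0] (fun ε : ℝ => ε) ∧
        (fun ε : ℝ => ε ^ 2) =O[𝓝[>] 0] δ ∧
        (X.rank = Fintype.card k → (fun ε : ℝ => ε) =O[𝓝[>] 0] δ)) := by
  obtain ⟨hkm, hkn⟩ := lt_min_iff.1 hk
  have hopen := locallyOpenAtIn_matrixMul_iff (X := X) (Y := Y) hkm hkn
  refine ⟨fun hne h => hne ((hopen.1 h).1.symm.trans (hopen.1 h).2), fun hXY => ?_, fun h => ?_⟩
  · rw [exists_rank_add_left_eq_card_iff hkm.le hXY, exists_rank_add_right_eq_card_iff hkn.le hXY,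
      finrank_ker_inf_range_eq_zero_iff, finrank_ker_inf_range_eq_zero_iff, hopen,
      ← Matrix.transpose_mul, Matrix.rank_transpose, Matrix.rank_transpose, hXY, and_self]
    tfae_finish
  obtain ⟨hX, hY⟩ := hopen.1 h
  have hsq : (fun ε : ℝ => ε ^ 2) =O[𝓝[>] 0] fun ε => ε :=
    ((isLittleO_pow_id one_lt_two).isBigO).mono nhdsWithin_le_nhds
  by_cases hr : X.rank = Fintype.card k
  · obtain ⟨δ, hδ, hΘ⟩ :=
      (locallyOpenOfOrder_one_matrixMul hr (hY.symm.trans (hX.trans hr))).exists_isTheta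
    simp only [pow_one] at hΘ
    exact ⟨δ, hδ, hΘ.1, hsq.trans hΘ.2, fun _ => hΘ.2⟩
  · obtain ⟨δ, hδ, hΘ⟩ := (locallyOpenOfOrder_two_matrixMul hX hY).exists_isTheta
    exact ⟨δ, hδ, hΘ.1.trans hsq, hΘ.2, fun h => absurd h hr⟩

theorem theorem1 (m k n : ℕ) (hk : k < min m n)
    (W₁ : Matrix (Fin m) (Fin k) ℝ) (W₂ : Matrix (Fin k) (Fin n) ℝ) :
    (W₁.rank ≠ W₂.rank → ¬ LocallyOpenAtIn (matMul m k n) (lowRank m k n) (W₁, W₂)) ∧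
    (W₁.rank = W₂.rank →
      List.TFAE [
        ∃ V₁ : Matrix (Fin m) (Fin k) ℝ, V₁ * W₂ = 0 ∧ (W₁ + V₁).rank = k,
        ∃ V₂ : Matrix (Fin k) (Fin n) ℝ, W₁ * V₂ = 0 ∧ (W₂ + V₂).rank = k,
        Module.finrank ℝ ↥(nullSp W₁ ⊓ colSp W₂) = 0,
        Module.finrank ℝ ↥(nullSp W₂.transpose ⊓ colSp W₁.transpose) = 0,
        LocallyOpenAtIn (matMul m k n) (lowRank m k n) (W₁, W₂)]) ∧
    (LocallyOpenAtIn (matMul m k n) (lowRank m k n) (W₁, W₂) →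
      ∃ δ : ℝ → ℝ,
        (∀ ε : ℝ, 0 < ε → 0 < δ ε ∧
          CoversBall (matMul m k n) (lowRank m k n) (W₁, W₂) ε (δ ε)) ∧
        δ =O[𝓝[>] 0] (fun ε : ℝ => ε) ∧
        (fun ε : ℝ => ε ^ 2) =O[𝓝[>] 0] δ ∧
        (W₁.rank = k → (fun ε : ℝ => ε) =O[𝓝[>] 0] δ)) := by
  have h := theorem1_general (by simpa using hk) W₁ W₂
  simp only [matrixMul_real_fin, range_matMul, Fintype.card_fin] at h
  exact h
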